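/- A mixed graph $G$ consists of a finite vertex set together with undirected edges and arcs (directed edges) between distinct vertices, where any two distinct vertices are joined by at most one undirected edge or arc. Its order is its number of vertices, and its size is the number of arcs plus twice the number of undirected edges. It is a mixed tree if forgetting the directions of the arcs gives a tree. Let $A$ be the $0$-$1$ matrix with $a_{ij}=1$ exactly when there is an arc from $i$ to $j$ or an undirected edge $ij$, and let $D^+$ be the diagonal matrix of the out-degrees $d_i^+=\sum_j a_{ij}$. For $\alpha\in[0,1]$, let $\rho_\alpha(G)$ be the largest real eigenvalue of $A_\alpha(G)=\alpha D^+ +(1-\alpha)A$. Let $P_k$ be the undirected path on $k$ vertices (a mixed path of order $k$ and size $2k-2$). Theorem. Let $\alpha\in[0,1]$, let $T$ be a mixed tree of order $n$ and size $m$, and set $k=\left\lceil \frac{n}{2n-m-1}\right\rceil$. Then the largest real eigenvalues $\rho_\alpha(T)$ and $\rho_\alpha(P_k)$ exist, and $$\rho_\alpha(T)\ge\rho_\alpha(P_k).$$ Moreover, for every $n\ge 1$ the path $P_n$ is a mixed tree of order $n$ and size $2n-2$, and the bound is attained when $T=P_n$ (up to isomorphism). -/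

import Mathlib

/-- A mixed graph on the vertex set `V`: undirected edges (a simple graph) together with arcs
(directed edges), such that two distinct vertices are joined by at most one undirected edge or arc.
Loops are excluded by `arc_asymm`. -/
@[ext]
structure MixedGraph (V : Type*) where
  /-- the undirected edges -/
  edge : SimpleGraph V
  /-- `arc u v`: there is an arc from `u` to `v` -/
  arc : V → V → Prop
  /-- there is no loop, and there are no two opposite arcs -/
  arc_asymm : ∀ u v, arc u v → ¬ arc v u
  /-- an arc and an undirected edge never join the same two vertices -/
  arc_not_edge : ∀ u v, arc u v → ¬ edge.Adj u v

namespace MixedGraph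

variable {V W : Type*}

/-- `v` is an out-neighbour of `u`: there is an arc from `u` to `v` or an undirected edge `uv`. -/
def OutAdj (G : MixedGraph V) (u v : V) : Prop := G.arc u v ∨ G.edge.Adj u v

/-- The underlying graph: forget the directions of the arcs. -/
def underlying (G : MixedGraph V) : SimpleGraph V where
  Adj u v := G.edge.Adj u v ∨ G.arc u v ∨ G.arc v u
  symm := ⟨fun u v h => by
    rcases h with h | h | h
    · exact Or.inl h.symm
    · exact Or.inr (Or.inr h)
    · exact Or.inr (Or.inl h)⟩
  loopless := ⟨fun u h => by
    rcases h with h | h | h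
    · exact G.edge.loopless.irrefl u h
    · exact G.arc_asymm u u h h
    · exact G.arc_asymm u u h h⟩

/-- A mixed tree is a mixed graph whose underlying graph is a tree. -/
def IsMixedTree (G : MixedGraph V) : Prop := G.underlying.IsTree

/-- The size: the number of arcs plus twice the number of undirected edges. -/
noncomputable def size (G : MixedGraph V) : ℕ :=
  {p : V × V | G.arc p.1 p.2}.ncard + 2 * G.edge.edgeSet.ncard

/-- The out-degree of a vertex. -/
noncomputable def outDegree (G : MixedGraph V) (u : V) : ℕ := {v | G.OutAdj u v}.ncard

open Classical in
/-- The adjacency matrix. -/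
noncomputable def adjacency (G : MixedGraph V) : Matrix V V ℝ :=
  Matrix.of fun u v => if G.OutAdj u v then 1 else 0

/-- The matrix `A_α = α D⁺ + (1 - α) A`, where `D⁺` is the diagonal matrix of out-degrees and
`A` is the adjacency matrix. -/
noncomputable def aAlpha [DecidableEq V] (α : ℝ) (G : MixedGraph V) : Matrix V V ℝ :=
  α • Matrix.diagonal (fun u => (G.outDegree u : ℝ)) + (1 - α) • G.adjacency

/-- The set of real eigenvalues of `A_α`. -/
def realEigenvalues [Fintype V] [DecidableEq V] (α : ℝ) (G : MixedGraph V) : Set ℝ :=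
  {r | Module.End.HasEigenvalue (G.aAlpha α).mulVecLin r}

/-- The `A_α`-spectral radius: the largest real eigenvalue of `A_α`. -/
noncomputable def rho [Fintype V] [DecidableEq V] (α : ℝ) (G : MixedGraph V) : ℝ :=
  sSup (G.realEigenvalues α)

/-- An undirected graph, seen as a mixed graph without arcs. -/
def ofSimpleGraph (G : SimpleGraph V) : MixedGraph V where
  edge := G
  arc _ _ := False
  arc_asymm _ _ h := h.elim
  arc_not_edge _ _ h := h.elim

/-- The undirected path on `k` vertices. -/
def path (k : ℕ) : MixedGraph (Fin k) := ofSimpleGraph (SimpleGraph.pathGraph k)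

/-- Two mixed graphs are isomorphic if a bijection of the vertices preserves, in both directions,
undirected edges and arcs. -/
def Isomorphic (G : MixedGraph V) (H : MixedGraph W) : Prop :=
  ∃ e : V ≃ W, (∀ u v, G.edge.Adj u v ↔ H.edge.Adj (e u) (e v)) ∧
    ∀ u v, G.arc u v ↔ H.arc (e u) (e v)

end MixedGraph

/-!
Deleting the arcs of the mixed tree `T` leaves a forest of undirected edges. If `T` has `a` arcs,
then `2n - m - 1 = a + 1` bounds the number of its components, so some component has at least
`k = ⌈n / (a + 1)⌉` vertices (`MixedGraph.exists_card_le_mul_card_reachable`).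

*Reduction to a symmetric matrix.* Every edge of a tree is a bridge, so summing, over the arcs, the
indicator function of the side of the head gives a function on the vertices that is constant along
undirected edges and increases along arcs (`MixedGraph.exists_potential`). With respect to it `A_α`
is block triangular, and its diagonal blocks are untouched by deleting the off-diagonal entries of
the arcs. Hence `A_α` has the characteristic polynomial of a symmetric matrix, its largest real
eigenvalue exists, and it is a maximum of Rayleigh quotients. In particular, a nonzero vector
`x ≥ 0` with `(A_α x) v ≥ r * x v` on its support, where only the undirected edges need to be taken
into account, shows `r ≤ ρ_α(T)` (`MixedGraph.le_rho_of_subsolution`).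

*The test vector.* Let `r = ρ_α(P_k)`, let `α < 1`, and let `p 1, …, p k` be the Perron vector of
`P_k`. In the eigenvalue equation of a path, a branch of `j` vertices contributes
`g j = α + (1 - α) * p j / p (j + 1)` times the entry at the vertex it hangs from. A Casoratian
identity and the log-concavity of `p` give `g (a + b) ≤ g a + g b` for `a + b < k`
(`MixedGraph.IsPathSequence.branchWeight_add_le`). Choose a tree with exactly `k` vertices inside
the large component, root it, and let the entry at the root of a branch of `j` vertices be
`p j / p (j + 1)` times the entry at its parent. Each vertex then receives from its branches at
least as much as from one path with equally many vertices, so the vector satisfies the required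
inequality (`SimpleGraph.RootedTree.exists_subsolution`). For `α = 1` the matrix is diagonal and
only out-degrees have to be compared (`MixedGraph.exists_rho_one_path_le`).
-/

open Finset Matrix

/-! ### Spectrum of symmetric real matrices -/

/-- The maximum of the Rayleigh quotient of a symmetric real matrix is attained at an eigenvalue. -/
theorem Matrix.exists_hasEigenvalue_forall_rayleigh_le {V : Type*} [Fintype V] [DecidableEq V]
    [Nonempty V] {M : Matrix V V ℝ} (hM : M.IsSymm) :
    ∃ μ : ℝ, Module.End.HasEigenvalue M.mulVecLin μ ∧
      ∀ x : V → ℝ, x ⬝ᵥ (M *ᵥ x) ≤ μ * (x ⬝ᵥ x) := by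
  have hH : M.IsHermitian := by rw [Matrix.IsHermitian, conjTranspose_eq_transpose_of_trivial, hM]
  set T := M.toEuclideanLin with hT
  have hS : T.IsSymmetric := isSymmetric_toEuclideanLin_iff.mpr hH
  set μ : ℝ := ⨆ x : { x : EuclideanSpace ℝ V // x ≠ 0 },
    inner ℝ (T x) x / ‖(x : EuclideanSpace ℝ V)‖ ^ 2 with hμ
  have hev : Module.End.HasEigenvalue T μ := hS.hasEigenvalue_iSup_of_finiteDimensional
  have hbdd : BddAbove (Set.range fun x : { x : EuclideanSpace ℝ V // x ≠ 0 } =>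
      inner ℝ (T x) x / ‖(x : EuclideanSpace ℝ V)‖ ^ 2) := by
    refine ⟨‖T.toContinuousLinearMap‖, ?_⟩
    rintro _ ⟨⟨x, hx⟩, rfl⟩
    have hpos : 0 < ‖x‖ := norm_pos_iff.mpr hx
    refine (div_le_iff₀ (by positivity)).mpr ?_
    calc inner ℝ (T x) x ≤ ‖T x‖ * ‖x‖ := real_inner_le_norm _ _
      _ ≤ (‖T.toContinuousLinearMap‖ * ‖x‖) * ‖x‖ := by
        gcongr
        exact T.toContinuousLinearMap.le_opNorm x
      _ = _ := by ring
  refine ⟨μ, ?_, fun x => ?_⟩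
  · obtain ⟨v, hv⟩ := hev.exists_hasEigenvector
    refine Module.End.hasEigenvalue_of_hasEigenvector (x := v.ofLp) ⟨?_, ?_⟩
    · rw [Module.End.mem_eigenspace_iff]
      have := hv.apply_eq_smul
      simpa [hT] using congrArg WithLp.ofLp this
    · simpa using hv.2
  · by_cases hx : x = 0
    · simp [hx]
    have hx' : WithLp.toLp 2 x ≠ 0 := by simpa using hx
    have h := le_ciSup hbdd ⟨WithLp.toLp 2 x, hx'⟩
    rw [← hμ] at h
    have hpos : 0 < ‖WithLp.toLp 2 x‖ := norm_pos_iff.mpr hx'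
    have h2 := (div_le_iff₀ (by positivity)).mp h
    rw [EuclideanSpace.real_norm_sq_eq] at h2
    simpa [EuclideanSpace.inner_eq_star_dotProduct, hT, dotProduct, pow_two] using h2

theorem Matrix.hasEigenvalue_mulVecLin_iff_isRoot_charpoly {V : Type*} [Fintype V] [DecidableEq V]
    {M : Matrix V V ℝ} {r : ℝ} :
    Module.End.HasEigenvalue M.mulVecLin r ↔ M.charpoly.IsRoot r := by
  rw [Module.End.hasEigenvalue_iff_isRoot_charpoly, charpoly_mulVecLin]

theorem Matrix.le_of_hasEigenvalue_of_forall_rayleigh_le {V : Type*} [Fintype V]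
    {M : Matrix V V ℝ} {μ r : ℝ} (h : ∀ x : V → ℝ, x ⬝ᵥ (M *ᵥ x) ≤ μ * (x ⬝ᵥ x))
    (hr : Module.End.HasEigenvalue M.mulVecLin r) : r ≤ μ := by
  obtain ⟨v, hv⟩ := hr.exists_hasEigenvector
  have h1 : M *ᵥ v = r • v := hv.apply_eq_smul
  have h2 := h v
  rw [h1, dotProduct_smul, smul_eq_mul] at h2
  have h3 : 0 < v ⬝ᵥ v := by
    have := dotProduct_star_self_pos_iff.mpr hv.2
    simpa using this
  exact le_of_mul_le_mul_right h2 h3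

namespace MixedGraph

variable {V W : Type*}

/-! ### The undirected part of `A_α` -/

/-- The matrix `A_α` with the entries of the arcs deleted: the out-degrees on the diagonal still
count the arcs, but off the diagonal only the undirected edges remain. -/
noncomputable def undirectedAAlpha [DecidableEq V] (α : ℝ) (G : MixedGraph V) : Matrix V V ℝ :=
  α • Matrix.diagonal (fun u => (G.outDegree u : ℝ)) + (1 - α) • (ofSimpleGraph G.edge).adjacency

theorem undirectedAAlpha_isSymm [DecidableEq V] (α : ℝ) (G : MixedGraph V) :
    (G.undirectedAAlpha α).IsSymm := by
  ext u v
  by_cases huv : u = v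
  · rw [huv, transpose_apply]
  · have hsymm := G.edge.adj_comm u v
    by_cases h : G.edge.Adj u v <;>
      simp [undirectedAAlpha, adjacency, OutAdj, ofSimpleGraph, huv, Ne.symm huv, h, ← hsymm]

theorem aAlpha_ofSimpleGraph [DecidableEq V] (α : ℝ) (H : SimpleGraph V) :
    (ofSimpleGraph H).aAlpha α = (ofSimpleGraph H).undirectedAAlpha α := rfl

open Classical in
theorem undirectedAAlpha_mulVec [Fintype V] [DecidableEq V] (α : ℝ) (G : MixedGraph V)
    (x : V → ℝ) (u : V) :
    (G.undirectedAAlpha α *ᵥ x) u =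
      α * G.outDegree u * x u + (1 - α) * ∑ v, if G.edge.Adj u v then x v else 0 := by
  simp only [undirectedAAlpha, add_mulVec, smul_mulVec, Pi.add_apply, Pi.smul_apply, smul_eq_mul,
    mulVec_diagonal, mul_assoc]
  congr 2
  simp [mulVec, dotProduct, adjacency, OutAdj, ofSimpleGraph]

open Classical in
theorem sum_edge_le_outDegree [Fintype V] (G : MixedGraph V) (u : V) :
    (∑ v, if G.edge.Adj u v then (1 : ℝ) else 0) ≤ G.outDegree u := by
  have h : G.outDegree u = #{v | G.OutAdj u v} := by
    rw [outDegree, Set.ncard_eq_toFinset_card']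
    congr 1; ext; simp
  rw [h, Finset.sum_boole]
  norm_cast
  refine card_le_card fun v hv => ?_
  simp only [mem_filter, mem_univ, true_and] at hv ⊢
  exact Or.inr hv

open Classical in
theorem outDegree_ofSimpleGraph [Fintype V] (H : SimpleGraph V) (u : V) :
    ((ofSimpleGraph H).outDegree u : ℝ) = ∑ v, if H.Adj u v then (1 : ℝ) else 0 := by
  have h : (ofSimpleGraph H).outDegree u = #{v | H.Adj u v} := by
    rw [outDegree, Set.ncard_eq_toFinset_card']
    congr 1; ext; simp [OutAdj, ofSimpleGraph]
  rw [h, Finset.sum_boole]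

open Classical in
/-- Dropping the arcs from the out-degrees as well can only decrease the entries of the
product with `x` where `x` is nonnegative. -/
theorem le_undirectedAAlpha_mulVec [Fintype V] [DecidableEq V] {α : ℝ} (hα : 0 ≤ α)
    (G : MixedGraph V) {x : V → ℝ} (u : V) (hx : 0 ≤ x u) :
    (∑ v, if G.edge.Adj u v then α * x u + (1 - α) * x v else 0) ≤
      (G.undirectedAAlpha α *ᵥ x) u := by
  rw [undirectedAAlpha_mulVec]
  have h1 : (∑ v, if G.edge.Adj u v then α * x u + (1 - α) * x v else 0) =
      α * (∑ v, if G.edge.Adj u v then (1 : ℝ) else 0) * x u +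
        (1 - α) * ∑ v, if G.edge.Adj u v then x v else 0 := by
    rw [mul_sum, mul_sum, sum_mul, ← sum_add_distrib]
    refine sum_congr rfl fun v _ => ?_
    split_ifs <;> ring
  rw [h1]
  have := G.sum_edge_le_outDegree u
  gcongr

open Classical in
theorem aAlpha_ofSimpleGraph_mulVec [Fintype V] [DecidableEq V] (α : ℝ)
    (H : SimpleGraph V) (x : V → ℝ) (u : V) :
    ((ofSimpleGraph H).aAlpha α *ᵥ x) u =
      ∑ v, if H.Adj u v then α * x u + (1 - α) * x v else 0 := by
  rw [aAlpha_ofSimpleGraph, undirectedAAlpha_mulVec, outDegree_ofSimpleGraph, mul_sum, mul_sum,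
    sum_mul, ← sum_add_distrib]
  refine sum_congr rfl fun v _ => ?_
  by_cases h : H.Adj u v
  · simp [ofSimpleGraph, h]
  · simp [ofSimpleGraph, h]

/-! ### Deleting the arcs of a mixed tree does not change the spectrum -/

/-- A height function on a mixed tree: constant along undirected edges, increasing along arcs. It
is the sum, over all arcs, of the indicator function of the side of the head, which is well defined
because every edge of the underlying tree is a bridge. -/
theorem exists_potential [Finite V] {T : MixedGraph V} (hT : T.IsMixedTree) :
    ∃ h : V → ℕ, (∀ u v, T.edge.Adj u v → h u = h v) ∧ ∀ u v, T.arc u v → h u < h v := by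
  classical
  have := Fintype.ofFinite V
  have hbr := SimpleGraph.isAcyclic_iff_forall_adj_isBridge.mp hT.isAcyclic
  -- `f p v = 1` if `v` lies on the head side of the arc `p`, and `0` otherwise
  let f : V × V → V → ℕ := fun p v =>
    if T.arc p.1 p.2 ∧ ¬ (T.underlying.deleteEdges {s(p.1, p.2)}).Reachable p.1 v then 1 else 0
  have key : ∀ p u v, T.underlying.Adj u v → s(p.1, p.2) ≠ s(u, v) → f p u = f p v := by
    intro p u v huv hne
    have hadj : (T.underlying.deleteEdges {s(p.1, p.2)}).Adj u v := by
      rw [SimpleGraph.deleteEdges_adj]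
      exact ⟨huv, fun h => hne (by simpa using h.symm)⟩
    have : (T.underlying.deleteEdges {s(p.1, p.2)}).Reachable p.1 u ↔
        (T.underlying.deleteEdges {s(p.1, p.2)}).Reachable p.1 v :=
      ⟨fun h => h.trans hadj.reachable, fun h => h.trans hadj.symm.reachable⟩
    simp only [f, this]
  refine ⟨fun v => ∑ p, f p v, fun u v huv => ?_, fun u v huv => ?_⟩
  · refine sum_congr rfl fun p _ => ?_
    by_cases hp : T.arc p.1 p.2
    · refine key p u v (Or.inl huv) fun h => ?_
      rw [Sym2.eq_iff] at h
      rcases h with ⟨h1, h2⟩ | ⟨h1, h2⟩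
      · exact T.arc_not_edge _ _ hp (by rwa [h1, h2])
      · exact T.arc_not_edge _ _ hp (by rw [h1, h2]; exact huv.symm)
    · simp [f, hp]
  · refine sum_lt_sum (fun p _ => ?_) ⟨(u, v), mem_univ _, ?_⟩
    · by_cases hp : T.arc p.1 p.2
      · by_cases h : s(p.1, p.2) = s(u, v)
        · rw [Sym2.eq_iff] at h
          rcases h with ⟨h1, h2⟩ | ⟨h1, h2⟩
          · have : f p u = 0 := by simp [f, h1]
            omega
          · exact absurd (by rwa [h1, h2] at hp) (T.arc_asymm u v huv)
        · exact (key p u v (Or.inr (Or.inl huv)) h).le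
      · simp [f, hp]
    · have hb := SimpleGraph.isBridge_iff.mp (hbr (Or.inr (Or.inl huv) : T.underlying.Adj u v))
      simp only [f, huv, true_and, SimpleGraph.Reachable.refl, not_true_eq_false, if_false]
      rw [if_pos]
      · exact Nat.one_pos
      · simpa using hb

/-- Both matrices are block triangular for the height function, with the same diagonal blocks, as
arcs never join two vertices of the same height. -/
theorem charpoly_aAlpha [Fintype V] [DecidableEq V] (α : ℝ) {T : MixedGraph V}
    (hT : T.IsMixedTree) : (T.aAlpha α).charpoly = (T.undirectedAAlpha α).charpoly := by
  obtain ⟨h, hedge, harc⟩ := exists_potential hT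
  have h1 : (T.aAlpha α).BlockTriangular h := by
    intro u v huv
    have hne : u ≠ v := by rintro rfl; exact lt_irrefl _ huv
    have hout : ¬ T.OutAdj u v := by
      rintro (h | h)
      · have := harc _ _ h; omega
      · have := hedge _ _ h; omega
    simp [aAlpha, adjacency, hne, hout]
  have h2 : (T.undirectedAAlpha α).BlockTriangular h := by
    intro u v huv
    have hne : u ≠ v := by rintro rfl; exact lt_irrefl _ huv
    have hout : ¬ T.edge.Adj u v := fun h => by have := hedge _ _ h; omega
    simp [undirectedAAlpha, adjacency, OutAdj, ofSimpleGraph, hne, hout]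
  rw [h1.charpoly, h2.charpoly]
  refine prod_congr rfl fun a _ => ?_
  congr 1
  ext ⟨u, hu⟩ ⟨v, hv⟩
  have hno : ¬ T.arc u v := fun h => by have := harc _ _ h; omega
  by_cases he : T.edge.Adj u v <;>
    simp [toSquareBlock_def, aAlpha, undirectedAAlpha, adjacency, OutAdj, ofSimpleGraph, hno, he]

theorem isGreatest_rho_and_rayleigh_le [Fintype V] [DecidableEq V] (α : ℝ) {T : MixedGraph V}
    (hT : T.IsMixedTree) : IsGreatest (T.realEigenvalues α) (T.rho α) ∧
      ∀ x : V → ℝ, x ⬝ᵥ (T.undirectedAAlpha α *ᵥ x) ≤ T.rho α * (x ⬝ᵥ x) := by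
  have := hT.connected.nonempty
  obtain ⟨μ, hμ, hmax⟩ := exists_hasEigenvalue_forall_rayleigh_le (T.undirectedAAlpha_isSymm α)
  have hiff : ∀ r, r ∈ T.realEigenvalues α ↔
      Module.End.HasEigenvalue (T.undirectedAAlpha α).mulVecLin r := fun r => by
    rw [realEigenvalues, Set.mem_ofPred_eq, hasEigenvalue_mulVecLin_iff_isRoot_charpoly,
      charpoly_aAlpha α hT, hasEigenvalue_mulVecLin_iff_isRoot_charpoly]
  have hg : IsGreatest (T.realEigenvalues α) μ :=
    ⟨(hiff μ).mpr hμ, fun r hr => le_of_hasEigenvalue_of_forall_rayleigh_le hmax ((hiff r).mp hr)⟩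
  have hrho : T.rho α = μ := hg.csSup_eq
  rw [hrho]
  exact ⟨hg, hmax⟩

open Classical in
/-- A nonnegative test vector bounds `ρ_α` from below. Only the undirected edges enter the
hypothesis, and only on the support of the vector. -/
theorem le_rho_of_subsolution [Fintype V] [DecidableEq V] {α r : ℝ} (hα : 0 ≤ α)
    {T : MixedGraph V} (hT : T.IsMixedTree) {x : V → ℝ} (hx : 0 ≤ x) (hx0 : x ≠ 0)
    (h : ∀ u, x u ≠ 0 → r * x u ≤ ∑ v, if T.edge.Adj u v then α * x u + (1 - α) * x v else 0) :
    r ≤ T.rho α := by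
  have h1 : r * (x ⬝ᵥ x) ≤ x ⬝ᵥ (T.undirectedAAlpha α *ᵥ x) := by
    rw [dotProduct, dotProduct, mul_sum]
    refine sum_le_sum fun u _ => ?_
    by_cases hu : x u = 0
    · simp [hu]
    calc r * (x u * x u) = x u * (r * x u) := by ring
      _ ≤ _ := mul_le_mul_of_nonneg_left
        ((h u hu).trans (le_undirectedAAlpha_mulVec hα T u (hx u))) (hx u)
  have h2 : 0 < x ⬝ᵥ x := by
    have := dotProduct_star_self_pos_iff.mpr hx0
    simpa using this
  exact le_of_mul_le_mul_right (h1.trans ((isGreatest_rho_and_rayleigh_le α hT).2 x)) h2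

end MixedGraph

/-! ### Rooted trees inside a graph -/

/-- `H.RootedTree S r`: the set `S` carries a tree of the graph `H` with root `r`, built from single
vertices by joining the root of one tree to the root of a disjoint one, which becomes a child. Extra
edges of `H` between the vertices of `S` are allowed. -/
inductive SimpleGraph.RootedTree {V : Type*} [DecidableEq V] (H : SimpleGraph V) :
    Finset V → V → Prop
  | single (r : V) : H.RootedTree {r} r
  | join {S S' : Finset V} {r c : V} (hS : H.RootedTree S r) (hS' : H.RootedTree S' c)
      (hd : Disjoint S S') (hrc : H.Adj r c) : H.RootedTree (S ∪ S') r

namespace SimpleGraph.RootedTree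

variable {V : Type*} [DecidableEq V] {H : SimpleGraph V} {S : Finset V} {r : V}

theorem root_mem (h : H.RootedTree S r) : r ∈ S := by
  induction h with
  | single r => simp
  | join _ _ _ _ ih _ => exact mem_union_left _ ih

theorem insert_leaf (h : H.RootedTree S r) {u w : V} (hu : u ∈ S) (hw : w ∉ S)
    (huw : H.Adj u w) : H.RootedTree (insert w S) r := by
  induction h with
  | single r =>
    obtain rfl := mem_singleton.mp hu
    have := join (single u) (single w) (by simpa using huw.ne) huw
    rwa [union_comm, ← insert_eq] at this
  | join hS hS' hd hrc ih ih' =>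
    rw [mem_union] at hu
    rw [mem_union, not_or] at hw
    rcases hu with hu | hu
    · rw [← insert_union]
      exact join (ih hu hw.1) hS' (disjoint_insert_left.mpr ⟨hw.2, hd⟩) hrc
    · rw [← union_insert]
      exact join hS (ih' hu hw.2) (disjoint_insert_right.mpr ⟨hw.1, hd⟩) hrc

open Classical in
/-- Growing leaf by leaf, a rooted tree attains every size up to that of the component of the
root. -/
theorem exists_card_eq [Fintype V] (H : SimpleGraph V) (r : V) {k : ℕ} (hk : 1 ≤ k)
    (hle : k ≤ #{v | H.Reachable r v}) : ∃ S, H.RootedTree S r ∧ #S = k := by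
  induction k, hk using Nat.le_induction with
  | base => exact ⟨{r}, single r, by simp⟩
  | succ k hk ih =>
    obtain ⟨S, hS, hcard⟩ := ih (by omega)
    have hlt : #S < #{v | H.Reachable r v} := by omega
    obtain ⟨w, hw, hwS⟩ := exists_mem_notMem_of_card_lt_card hlt
    simp only [mem_filter, mem_univ, true_and] at hw
    obtain ⟨p⟩ := hw
    obtain ⟨d, -, hd, hd'⟩ := p.exists_boundary_dart S hS.root_mem hwS
    exact ⟨_, hS.insert_leaf hd hd' d.adj, by rw [card_insert_of_notMem hd', hcard]⟩

theorem exists_adj_root (h : H.RootedTree S r) (hS : 2 ≤ #S) : ∃ u ∈ S, H.Adj r u := by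
  cases h with
  | single r => simp at hS
  | join _ hS' _ hrc => exact ⟨_, mem_union_right _ hS'.root_mem, hrc⟩

open Classical in
theorem exists_two_le_degree (h : H.RootedTree S r) (hS : 3 ≤ #S) :
    ∃ v ∈ S, 2 ≤ #{u ∈ S | H.Adj v u} := by
  cases h with
  | single r => simp at hS
  | @join S S' r c h1 h2 hd hrc =>
    rw [card_union_of_disjoint hd] at hS
    by_cases hS1 : 2 ≤ #S
    · obtain ⟨u, hu, hru⟩ := h1.exists_adj_root hS1
      refine ⟨r, mem_union_left _ h1.root_mem, ?_⟩
      rw [Nat.succ_le_iff, one_lt_card]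
      exact ⟨u, by simp [hu, hru], c, by simp [h2.root_mem, hrc],
        fun h => Finset.disjoint_left.mp hd hu (h ▸ h2.root_mem)⟩
    · obtain ⟨u, hu, hcu⟩ := h2.exists_adj_root (by omega)
      refine ⟨c, mem_union_right _ h2.root_mem, ?_⟩
      rw [Nat.succ_le_iff, one_lt_card]
      exact ⟨r, by simp [h1.root_mem, hrc.symm], u, by simp [hu, hcu],
        fun h => Finset.disjoint_left.mp hd h1.root_mem (h ▸ hu)⟩

end SimpleGraph.RootedTree

namespace MixedGraph

variable {V W : Type*}

/-! ### Counting arcs, edges and components -/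

theorem ncard_arc_add_ncard_edgeSet [Finite V] {T : MixedGraph V} (hT : T.IsMixedTree) :
    {p : V × V | T.arc p.1 p.2}.ncard + T.edge.edgeSet.ncard + 1 = Nat.card V := by
  have h := (SimpleGraph.isTree_iff_connected_and_card.mp hT).2
  rw [← h, Nat.card_coe_set_eq]
  congr 1
  have hinj : Set.InjOn (fun p : V × V => s(p.1, p.2)) {p : V × V | T.arc p.1 p.2} := by
    rintro ⟨a, b⟩ hab ⟨c, d⟩ hcd h
    rcases Sym2.eq_iff.mp h with ⟨h1, h2⟩ | ⟨h1, h2⟩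
    · exact Prod.ext h1 h2
    · simp only at h1 h2
      subst h1 h2
      exact absurd hcd (T.arc_asymm _ _ hab)
  rw [← hinj.ncard_image, ← Set.ncard_union_eq]
  · congr 1
    ext e
    induction e with | _ u v =>
    simp only [Set.mem_union, Set.mem_image, Prod.exists, SimpleGraph.mem_edgeSet, underlying]
    constructor
    · rintro (⟨a, b, hab, h⟩ | h)
      · rcases Sym2.eq_iff.mp h with ⟨rfl, rfl⟩ | ⟨rfl, rfl⟩
        · exact Or.inr (Or.inl hab)
        · exact Or.inr (Or.inr hab)
      · exact Or.inl h
    · rintro (h | h | h)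
      · exact Or.inr h
      · exact Or.inl ⟨u, v, h, rfl⟩
      · exact Or.inl ⟨v, u, h, Sym2.eq_swap⟩
  · rw [Set.disjoint_left]
    rintro _ ⟨⟨a, b⟩, hab, rfl⟩ h
    exact T.arc_not_edge _ _ hab h

/-- Contracting the components of the undirected part leaves a connected graph whose edges come from
arcs. -/
theorem card_connectedComponent_edge_le [Finite V] {T : MixedGraph V} (hT : T.IsMixedTree) :
    Nat.card T.edge.ConnectedComponent ≤ {p : V × V | T.arc p.1 p.2}.ncard + 1 := by
  -- contract every component of the undirected part to a single vertex
  let Q : SimpleGraph T.edge.ConnectedComponent := SimpleGraph.fromRel fun C D =>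
    ∃ u v, T.arc u v ∧ T.edge.connectedComponentMk u = C ∧ T.edge.connectedComponentMk v = D
  have harc : ∀ u v, T.arc u v →
      Q.Reachable (T.edge.connectedComponentMk u) (T.edge.connectedComponentMk v) := by
    intro u v huv
    by_cases h : T.edge.connectedComponentMk u = T.edge.connectedComponentMk v
    · rw [h]
    · exact SimpleGraph.Adj.reachable
        ((SimpleGraph.fromRel_adj _ _ _).mpr ⟨h, Or.inl ⟨u, v, huv, rfl, rfl⟩⟩)
  have hwalk : ∀ {u v : V}, T.underlying.Walk u v →
      Q.Reachable (T.edge.connectedComponentMk u) (T.edge.connectedComponentMk v) := by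
    intro u v p
    induction p with
    | nil => exact SimpleGraph.Reachable.refl _
    | cons h p ih =>
      refine SimpleGraph.Reachable.trans ?_ ih
      rcases h with h | h | h
      · rw [SimpleGraph.ConnectedComponent.sound h.reachable]
      · exact harc _ _ h
      · exact (harc _ _ h).symm
  have hconn : Q.Connected := by
    have := hT.connected.nonempty
    refine SimpleGraph.Connected.mk fun C D => ?_
    induction C using SimpleGraph.ConnectedComponent.ind with | _ u =>
    induction D using SimpleGraph.ConnectedComponent.ind with | _ v =>
    exact hwalk (hT.connected.preconnected u v).some
  refine hconn.card_vert_le_card_edgeSet_add_one.trans (Nat.add_le_add_right ?_ 1)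
  rw [Nat.card_coe_set_eq]
  have hsub : Q.edgeSet ⊆ (fun p : V × V =>
      s(T.edge.connectedComponentMk p.1, T.edge.connectedComponentMk p.2)) ''
        {p : V × V | T.arc p.1 p.2} := by
    intro e he
    induction e with | _ C D =>
    rw [SimpleGraph.mem_edgeSet, SimpleGraph.fromRel_adj] at he
    rcases he.2 with ⟨u, v, h, rfl, rfl⟩ | ⟨u, v, h, rfl, rfl⟩
    · exact ⟨(u, v), h, rfl⟩
    · exact ⟨(u, v), h, Sym2.eq_swap⟩
  exact (Set.ncard_le_ncard hsub).trans (Set.ncard_image_le)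

open Classical in
theorem exists_card_le_mul_card_reachable [Fintype V] {T : MixedGraph V} (hT : T.IsMixedTree) :
    ∃ r, Fintype.card V ≤
      #{v | T.edge.Reachable r v} * ({p : V × V | T.arc p.1 p.2}.ncard + 1) := by
  have := hT.connected.nonempty
  obtain ⟨r, -, hr⟩ := exists_max_image univ (fun r => #{v | T.edge.Reachable r v}) univ_nonempty
  refine ⟨r, ?_⟩
  have h1 := card_le_mul_card_image_of_maps_to (s := (univ : Finset V))
    (t := (univ : Finset T.edge.ConnectedComponent)) (f := T.edge.connectedComponentMk)
    (fun _ _ => mem_univ _) (#{v | T.edge.Reachable r v}) (fun C _ => by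
      induction C using SimpleGraph.ConnectedComponent.ind with | _ u =>
      refine le_trans (card_le_card fun v hv => ?_) (hr u (mem_univ _))
      simp only [mem_filter, mem_univ, true_and, SimpleGraph.ConnectedComponent.eq] at hv ⊢
      exact hv.symm)
  rw [card_univ, card_univ, ← Nat.card_eq_fintype_card (α := T.edge.ConnectedComponent)] at h1
  exact h1.trans (Nat.mul_le_mul_left _ (card_connectedComponent_edge_le hT))

/-! ### The undirected path -/

theorem card_edgeSet_pathGraph (n : ℕ) : (SimpleGraph.pathGraph (n + 1)).edgeSet.ncard = n := by
  have h : (SimpleGraph.pathGraph (n + 1)).edgeSet =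
      Set.range fun i : Fin n => s(i.castSucc, i.succ) := by
    ext e
    induction e with | _ u v =>
    rw [SimpleGraph.mem_edgeSet, SimpleGraph.pathGraph_adj, Set.mem_range]
    constructor
    · rintro (h | h)
      · exact ⟨⟨u, by omega⟩, by rw [Sym2.eq_iff]; left; constructor <;> ext <;> simp [h]⟩
      · exact ⟨⟨v, by omega⟩, by rw [Sym2.eq_iff]; right; constructor <;> ext <;> simp [h]⟩
    · rintro ⟨i, hi⟩
      rcases Sym2.eq_iff.mp hi with ⟨rfl, rfl⟩ | ⟨rfl, rfl⟩ <;> simp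
  rw [h, ← Set.image_univ, Set.ncard_image_of_injective, Set.ncard_univ, Nat.card_fin]
  intro i j hij
  rcases Sym2.eq_iff.mp hij with ⟨h1, -⟩ | ⟨h1, h2⟩
  · exact Fin.castSucc_injective _ h1
  · simp only [Fin.ext_iff, Fin.val_castSucc, Fin.val_succ] at h1 h2
    omega

theorem underlying_ofSimpleGraph (H : SimpleGraph V) : (ofSimpleGraph H).underlying = H := by
  ext u v
  simp [underlying, ofSimpleGraph]

theorem isMixedTree_path {n : ℕ} (hn : 1 ≤ n) : (path n).IsMixedTree := by
  obtain ⟨n, rfl⟩ := Nat.exists_eq_add_of_le' hn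
  rw [IsMixedTree, path, underlying_ofSimpleGraph, SimpleGraph.isTree_iff_connected_and_card,
    Nat.card_coe_set_eq, card_edgeSet_pathGraph, Nat.card_fin]
  exact ⟨SimpleGraph.pathGraph_connected n, rfl⟩

theorem size_path {n : ℕ} (hn : 1 ≤ n) : (path n).size + 2 = 2 * n := by
  obtain ⟨n, rfl⟩ := Nat.exists_eq_add_of_le' hn
  simp only [size, path, ofSimpleGraph, card_edgeSet_pathGraph]
  simp
  omega

open Classical in
theorem sum_pathGraph_adj {k : ℕ} (i : Fin k) (f : ℕ → ℝ) :
    (∑ j : Fin k, if (SimpleGraph.pathGraph k).Adj i j then f j else 0) =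
      (if 1 ≤ (i : ℕ) then f (i - 1) else 0) + if (i : ℕ) + 1 < k then f (i + 1) else 0 := by
  have h1 : ∀ j : Fin k, (if (SimpleGraph.pathGraph k).Adj i j then f j else 0) =
      (if (j : ℕ) + 1 = i then f j else 0) + if (i : ℕ) + 1 = j then f j else 0 := by
    intro j
    rw [SimpleGraph.pathGraph_adj]
    split_ifs <;> first | omega | simp
  simp_rw [h1]
  rw [sum_add_distrib, Fin.sum_univ_eq_sum_range (fun j => if j + 1 = (i : ℕ) then f j else 0),
    Fin.sum_univ_eq_sum_range (fun j => if (i : ℕ) + 1 = j then f j else 0)]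
  congr 1
  · rcases Nat.eq_zero_or_pos (i : ℕ) with h | h
    · simp [h]
    · have : ∀ j, j + 1 = (i : ℕ) ↔ j = i - 1 := by omega
      have hi := i.2
      simp only [this, sum_ite_eq', mem_range]
      rw [if_pos (by omega), if_pos (by omega : 1 ≤ (i : ℕ))]
  · simp [sum_ite_eq]

/-- A nonnegative eigenvector for `ρ_α` in the undirected case: the absolute value of any
eigenvector still maximizes the Rayleigh quotient. -/
theorem exists_nonneg_eigenvector [Fintype V] [DecidableEq V] {α : ℝ} (hα : α ∈ Set.Icc (0 : ℝ) 1)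
    {H : SimpleGraph V} (hH : (ofSimpleGraph H).IsMixedTree) :
    ∃ x : V → ℝ, 0 ≤ x ∧ x ≠ 0 ∧
      (ofSimpleGraph H).aAlpha α *ᵥ x = (ofSimpleGraph H).rho α • x := by
  obtain ⟨⟨hev, -⟩, hray⟩ := isGreatest_rho_and_rayleigh_le α hH
  obtain ⟨z, hz⟩ := Module.End.HasEigenvalue.exists_hasEigenvector hev
  set M := (ofSimpleGraph H).aAlpha α with hM
  set μ := (ofSimpleGraph H).rho α
  change ∀ x : V → ℝ, x ⬝ᵥ (M *ᵥ x) ≤ μ * (x ⬝ᵥ x) at hray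
  have hzM : M *ᵥ z = μ • z := hz.apply_eq_smul
  have hnonneg : ∀ u v, 0 ≤ M u v := by
    intro u v
    have h1 : 0 ≤ 1 - α := sub_nonneg.mpr hα.2
    simp only [hM, aAlpha, adjacency,
      Matrix.add_apply, Matrix.smul_apply, diagonal_apply, of_apply, smul_eq_mul]
    refine add_nonneg (mul_nonneg hα.1 ?_) (mul_nonneg h1 ?_) <;> split_ifs <;> positivity
  have hpsd : (μ • (1 : Matrix V V ℝ) - M).PosSemidef := by
    refine PosSemidef.of_dotProduct_mulVec_nonneg ?_ fun x => ?_
    · have h : M.IsSymm := undirectedAAlpha_isSymm α (ofSimpleGraph H)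
      rw [Matrix.IsHermitian, conjTranspose_eq_transpose_of_trivial]
      simp [h.eq]
    · have := hray x
      simp only [star_trivial, sub_mulVec, smul_mulVec, one_mulVec, dotProduct_sub, dotProduct_smul,
        smul_eq_mul]
      linarith
  -- replacing an eigenvector for the largest eigenvalue by its absolute value does not decrease
  -- the quadratic form, so the result is again an eigenvector
  have habs : |z| ⬝ᵥ |z| = z ⬝ᵥ z := by simp [dotProduct]
  have hle : z ⬝ᵥ (M *ᵥ z) ≤ |z| ⬝ᵥ (M *ᵥ |z|) := by
    simp only [dotProduct, mulVec, mul_sum]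
    refine sum_le_sum fun u _ => sum_le_sum fun v _ => ?_
    calc z u * (M u v * z v) ≤ |z u * (M u v * z v)| := le_abs_self _
      _ = _ := by rw [abs_mul, abs_mul, abs_of_nonneg (hnonneg u v)]; rfl
  have hzero : star |z| ⬝ᵥ ((μ • (1 : Matrix V V ℝ) - M) *ᵥ |z|) = 0 := by
    have h1 := hray |z|
    rw [hzM, dotProduct_smul, smul_eq_mul, ← habs] at hle
    simp only [star_trivial, sub_mulVec, smul_mulVec, one_mulVec, dotProduct_sub, dotProduct_smul,
      smul_eq_mul]
    linarith
  refine ⟨|z|, abs_nonneg z, by simpa using hz.2, ?_⟩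
  have := (hpsd.dotProduct_mulVec_zero_iff _).mp hzero
  rw [sub_mulVec, smul_mulVec, one_mulVec, sub_eq_zero] at this
  exact this.symm

/-- `IsPathSequence α r k p`: the entries `p 1, …, p k` form a positive eigenvector of `A_α` of the
undirected path on `k` vertices for the eigenvalue `r`, normalized by `p 1 = 1`. The sequence is
extended by the three-term recurrence at interior vertices; the conditions at the two ends are then
boundary conditions involving the ghost entries `p 0` and `p (k + 1)`. -/
structure IsPathSequence (α r : ℝ) (k : ℕ) (p : ℕ → ℝ) : Prop where
  one : p 1 = 1
  left : α * p 1 + (1 - α) * p 0 = 0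
  recur : ∀ j, (1 - α) * (p j + p (j + 2)) = (r - 2 * α) * p (j + 1)
  pos : ∀ j, 1 ≤ j → j ≤ k → 0 < p j
  right : α * p k + (1 - α) * p (k + 1) = 0

/-- The quantity `p (j + 1) ^ 2 - p j * p (j + 2)` is conserved by the three-term recurrence. -/
theorem casoratian_eq {b c : ℝ} (hb : b ≠ 0) {p : ℕ → ℝ}
    (hrec : ∀ j, b * (p j + p (j + 2)) = c * p (j + 1)) (j : ℕ) :
    p (j + 1) ^ 2 - p j * p (j + 2) = p 1 ^ 2 - p 0 * p 2 := by
  induction j with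
  | zero => rfl
  | succ j ih =>
    rw [← ih]
    refine mul_left_cancel₀ hb ?_
    linear_combination p (j + 2) * hrec j - p (j + 1) * hrec (j + 1)

/-- The Perron vector of the undirected path, as a sequence. -/
theorem exists_isPathSequence {α : ℝ} (h0 : 0 ≤ α) (h1 : α < 1) {k : ℕ} (hk : 1 ≤ k) :
    ∃ p, IsPathSequence α ((path k).rho α) k p := by
  classical
  set r := (path k).rho α
  have hβ : 0 < 1 - α := sub_pos.mpr h1
  obtain ⟨x, hx, hx0, hxr⟩ := exists_nonneg_eigenvector ⟨h0, h1.le⟩ (isMixedTree_path hk)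
  change (ofSimpleGraph (SimpleGraph.pathGraph k)).aAlpha α *ᵥ x = r • x at hxr
  let w : ℕ → ℝ := fun j => if h : j < k then x ⟨j, h⟩ else 0
  have hw : ∀ i : Fin k, w i = x i := fun i => by simp [w]
  have hw0 : ∀ j, 0 ≤ w j := fun j => by
    simp only [w]; split_ifs
    · exact hx _
    · exact le_rfl
  have heq : ∀ i, i < k → (if 1 ≤ i then α * w i + (1 - α) * w (i - 1) else 0) +
      (if i + 1 < k then α * w i + (1 - α) * w (i + 1) else 0) = r * w i := by
    intro i hi
    have h := congrFun hxr ⟨i, hi⟩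
    rw [aAlpha_ofSimpleGraph_mulVec, Pi.smul_apply, smul_eq_mul] at h
    simp only [← hw] at h
    rw [sum_pathGraph_adj (⟨i, hi⟩ : Fin k) fun j => α * w i + (1 - α) * w j] at h
    exact h
  obtain ⟨p, p0, p1, hrec⟩ : ∃ p : ℕ → ℝ, p 0 = -α / (1 - α) ∧ p 1 = 1 ∧
      ∀ j, (1 - α) * (p j + p (j + 2)) = (r - 2 * α) * p (j + 1) := by
    -- the pair `(p j, p (j + 1))` is computed by iterating the recurrence
    let q : ℕ → ℝ × ℝ := fun j => Nat.rec (-α / (1 - α), 1)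
      (fun _ s => (s.2, (r - 2 * α) / (1 - α) * s.2 - s.1)) j
    refine ⟨fun j => (q j).1, rfl, rfl, fun j => ?_⟩
    have prec : (q (j + 2)).1 = (r - 2 * α) / (1 - α) * (q (j + 1)).1 - (q j).1 := rfl
    simp only [prec]
    field_simp
    ring
  have hleft : α * p 1 + (1 - α) * p 0 = 0 := by rw [p1, p0]; field_simp; ring
  have hwp : ∀ j, (j < k → w j = w 0 * p (j + 1)) ∧ (j + 1 < k → w (j + 1) = w 0 * p (j + 2)) := by
    intro j
    induction j with
    | zero =>
      refine ⟨fun _ => by rw [zero_add, p1, mul_one], fun hlt => mul_left_cancel₀ hβ.ne' ?_⟩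
      have := heq 0 (by omega)
      rw [if_neg (by omega), if_pos (by omega)] at this
      linear_combination this - w 0 * hrec 0 + w 0 * hleft - (r - α) * w 0 * p1
    | succ j ih =>
      refine ⟨ih.2, fun hlt => mul_left_cancel₀ hβ.ne' ?_⟩
      have := heq (j + 1) (by omega)
      rw [if_pos (by omega), if_pos (by omega), Nat.add_sub_cancel] at this
      have e1 := ih.1 (by omega)
      have e2 := ih.2 (by omega)
      linear_combination this - w 0 * hrec (j + 1) + (r - 2 * α) * e2 - (1 - α) * e1
  have hwpos : 0 < w 0 := by
    refine (hw0 0).lt_of_ne fun h => hx0 ?_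
    ext i
    rw [← hw, (hwp i).1 i.2, ← h, zero_mul, Pi.zero_apply]
  have hright : α * p k + (1 - α) * p (k + 1) = 0 := by
    obtain ⟨l, rfl⟩ := Nat.exists_eq_add_of_le' hk
    have := heq l (by omega)
    rw [if_neg (by omega : ¬ l + 1 < l + 1)] at this
    refine mul_left_cancel₀ hwpos.ne' ?_
    rcases l with _ | l
    · rw [if_neg (by omega)] at this
      have e := (hwp 0).1 (by omega)
      linear_combination w 0 * hrec 0 - w 0 * hleft - this + r * w 0 * (p1)
    · rw [if_pos (by omega), Nat.add_sub_cancel, (hwp l).1 (by omega), (hwp l).2 (by omega)] at this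
      linear_combination w 0 * hrec (l + 1) - this
  have hnonneg : ∀ j, 1 ≤ j → j ≤ k → 0 ≤ p j := by
    intro j h1 hj
    obtain ⟨l, rfl⟩ := Nat.exists_eq_add_of_le' h1
    have := hw0 l
    rw [(hwp l).1 (by omega)] at this
    exact nonneg_of_mul_nonneg_right this hwpos
  refine ⟨p, p1, hleft, hrec, fun j h1 hj => (hnonneg j h1 hj).lt_of_ne fun hzero => ?_, hright⟩
  -- a zero of the sequence would contradict the conserved quantity being positive
  obtain ⟨l, rfl⟩ := Nat.exists_eq_add_of_le' h1
  rcases l with _ | l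
  · rw [zero_add, p1] at hzero; exact zero_ne_one hzero
  have hcas := casoratian_eq hβ.ne' hrec (l + 1)
  have hp0 : p 0 ≤ 0 := by rw [p0]; exact div_nonpos_of_nonpos_of_nonneg (by linarith) hβ.le
  have hp2 := hnonneg 2 (by omega) (by omega)
  have hD : 0 < p 1 ^ 2 - p 0 * p 2 := by rw [p1]; nlinarith
  have hz : p (l + 3) = - p (l + 1) := by
    have := hrec (l + 1)
    rw [← hzero, mul_zero] at this
    have := (mul_eq_zero.mp this).resolve_left hβ.ne'
    linear_combination this
  rw [← hcas, ← hzero, show l + 1 + 2 = l + 3 from rfl, hz] at hD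
  have : p (l + 1) = 0 := by
    rcases Nat.lt_or_ge (l + 2) k with hlt | hge
    · have a1 := hnonneg (l + 3) (by omega) (by omega)
      have a2 := hnonneg (l + 1) (by omega) (by omega)
      linarith
    · have hkl : k = l + 1 + 1 := by omega
      rw [hkl, ← hzero, mul_zero, zero_add] at hright
      have := (mul_eq_zero.mp hright).resolve_left hβ.ne'
      change p (l + 3) = 0 at this
      linarith
  rw [this] at hD
  norm_num at hD

/-! ### Branch weights -/

namespace IsPathSequence

variable {α r : ℝ} {k : ℕ} {p : ℕ → ℝ}

/-- Log-concavity of a path sequence. -/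
theorem mul_le_sq (hp : IsPathSequence α r k p) (h0 : 0 ≤ α) (h1 : α < 1) (hk : 2 ≤ k)
    (j : ℕ) : p j * p (j + 2) ≤ p (j + 1) ^ 2 := by
  have hβ : 0 < 1 - α := sub_pos.mpr h1
  have hcas := casoratian_eq hβ.ne' hp.recur j
  have hp2 := hp.pos 2 (by omega) hk
  have hp0 : p 0 ≤ 0 := by
    have := hp.left
    rw [hp.one] at this
    by_contra! h
    have := mul_pos hβ h
    linarith
  nlinarith [mul_nonneg (neg_nonneg.mpr hp0) hp2.le, sq_nonneg (p 1)]

theorem ratio_antitone (hp : IsPathSequence α r k p) (h0 : 0 ≤ α) (h1 : α < 1) {j i : ℕ}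
    (hji : j ≤ i) (hi : i + 2 ≤ k) : p (i + 2) * p (j + 1) ≤ p (j + 2) * p (i + 1) := by
  induction i, hji using Nat.le_induction with
  | base => exact le_rfl
  | succ i hji ih =>
    have ih := ih (by omega)
    have hlc := hp.mul_le_sq h0 h1 (by omega) (i + 1)
    have q1 := hp.pos (i + 1) (by omega) (by omega)
    have q2 := hp.pos (i + 2) (by omega) (by omega)
    have q3 := hp.pos (j + 1) (by omega) (by omega)
    refine le_of_mul_le_mul_left ?_ q1
    calc p (i + 1) * (p (i + 1 + 2) * p (j + 1))
        = (p (i + 1) * p (i + 1 + 2)) * p (j + 1) := by ring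
      _ ≤ p (i + 2) ^ 2 * p (j + 1) := mul_le_mul_of_nonneg_right hlc q3.le
      _ = p (i + 2) * (p (i + 2) * p (j + 1)) := by ring
      _ ≤ p (i + 2) * (p (j + 2) * p (i + 1)) := mul_le_mul_of_nonneg_left ih q2.le
      _ = p (i + 1) * (p (j + 2) * p (i + 1 + 1)) := by ring

theorem submultiplicative (hp : IsPathSequence α r k p) (h0 : 0 ≤ α) (h1 : α < 1) {a b : ℕ}
    (hab : a + b + 1 ≤ k) : p (a + b + 1) ≤ p (a + 1) * p (b + 1) := by
  induction a with
  | zero => simp [hp.one]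
  | succ a ih =>
    have ih := ih (by omega)
    have q1 := hp.pos (a + 1) (by omega) (by omega)
    have q2 := hp.pos (a + 2) (by omega) (by omega)
    have hr := hp.ratio_antitone h0 h1 (Nat.le_add_right a b) (by omega)
    have e : a + 1 + b + 1 = a + b + 2 := by omega
    rw [e]
    refine le_of_mul_le_mul_right ?_ q1
    calc p (a + b + 2) * p (a + 1) ≤ p (a + 2) * p (a + b + 1) := hr
      _ ≤ p (a + 2) * (p (a + 1) * p (b + 1)) := mul_le_mul_of_nonneg_left ih q2.le
      _ = p (a + 1 + 1) * p (b + 1) * p (a + 1) := by ring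

end IsPathSequence

/-- The contribution of a branch with `j` vertices to the eigenvalue equation at the vertex it hangs
from, relative to the entry at that vertex, when the branch is a path. -/
noncomputable def branchWeight (α : ℝ) (p : ℕ → ℝ) (j : ℕ) : ℝ := α + (1 - α) * (p j / p (j + 1))

namespace IsPathSequence

variable {α r : ℝ} {k : ℕ} {p : ℕ → ℝ}

theorem branchWeight_mul (hp : IsPathSequence α r k p) {j : ℕ} (hj : j + 1 ≤ k) :
    branchWeight α p j * p (j + 1) = α * p (j + 1) + (1 - α) * p j := by
  have := (hp.pos (j + 1) (by omega) hj).ne'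
  rw [branchWeight]
  field_simp

theorem branchWeight_zero (hp : IsPathSequence α r k p) : branchWeight α p 0 = 0 := by
  rw [branchWeight, zero_add, hp.one, div_one, ← hp.left, hp.one, mul_one]

/-- The eigenvalue equation at the end vertex of the path, seen as a root with a single branch. -/
theorem branchWeight_last (hp : IsPathSequence α r k p) (hk : 1 ≤ k) :
    branchWeight α p (k - 1) = r := by
  obtain ⟨l, rfl⟩ := Nat.exists_eq_add_of_le' hk
  rw [Nat.add_sub_cancel]
  refine mul_right_cancel₀ (hp.pos (l + 1) hk le_rfl).ne' ?_
  rw [hp.branchWeight_mul le_rfl]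
  linear_combination hp.recur l - hp.right

/-- Subadditivity: two path branches contribute at least as much as a single one with the same
number of vertices. -/
theorem branchWeight_add_le (hp : IsPathSequence α r k p) (h0 : 0 ≤ α) (h1 : α < 1) {a b : ℕ}
    (hab : a + b + 1 ≤ k) :
    branchWeight α p (a + b) ≤ branchWeight α p a + branchWeight α p b := by
  have hβ : 0 < 1 - α := sub_pos.mpr h1
  -- the defect of the eigenvalue equation at a vertex with branches `a` and `b` depends on `a + b`
  have hW : ∀ b a, (1 - α) * (p (a + 2) * p (b + 1) - p (a + 1) * p b) =
      α * p (a + b + 1) + (1 - α) * p (a + b + 2) := by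
    intro b
    induction b with
    | zero =>
      intro a
      rw [zero_add, add_zero, hp.one]
      have := hp.left
      rw [hp.one] at this
      linear_combination -p (a + 1) * this
    | succ b ih =>
      intro a
      have h := ih (a + 1)
      rw [show a + 1 + b = a + (b + 1) by omega] at h
      rw [← h]
      linear_combination p (a + 2) * hp.recur b - p (b + 1) * hp.recur (a + 1)
  have hpos : 0 ≤ α * p (a + b + 1) + (1 - α) * p (a + b + 2) := by
    rcases Nat.lt_or_ge (a + b + 1) k with h | h
    · have q1 := hp.pos (a + b + 1) (by omega) hab
      have q2 := hp.pos (a + b + 2) (by omega) (by omega)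
      positivity
    · have : k = a + b + 1 := by omega
      subst this
      exact hp.right.ge
  have qa := hp.pos (a + 1) (by omega) (by omega)
  have qb := hp.pos (b + 1) (by omega) (by omega)
  have qs := hp.pos (a + b + 1) (by omega) hab
  have ea : r - branchWeight α p a - branchWeight α p b =
      (α * p (a + b + 1) + (1 - α) * p (a + b + 2)) / (p (a + 1) * p (b + 1)) := by
    rw [eq_div_iff (mul_pos qa qb).ne', ← hW]
    linear_combination -p (b + 1) * hp.branchWeight_mul (j := a) (by omega)
      - p (a + 1) * hp.branchWeight_mul (j := b) (by omega) - p (b + 1) * hp.recur a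
  have es : r - branchWeight α p (a + b) =
      (α * p (a + b + 1) + (1 - α) * p (a + b + 2)) / p (a + b + 1) := by
    rw [eq_div_iff qs.ne']
    linear_combination -hp.branchWeight_mul hab - hp.recur (a + b)
  have := div_le_div_of_nonneg_left hpos qs (hp.submultiplicative h0 h1 hab)
  rw [← ea, ← es] at this
  linarith

end IsPathSequence

/-! ### The test vector on a rooted tree -/

open Classical in
/-- The test vector on a rooted tree with at most `k` vertices. Away from the root it satisfies the
eigenvalue inequality; at the root it receives at least what a single path branch formed by the
other vertices would contribute. Joining two trees scales the vector of the new child's tree. -/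
theorem _root_.SimpleGraph.RootedTree.exists_subsolution [DecidableEq V] {H : SimpleGraph V}
    {S : Finset V} {o : V} (hS : H.RootedTree S o) {α r : ℝ} {k : ℕ} {p : ℕ → ℝ}
    (hp : IsPathSequence α r k p) (h0 : 0 ≤ α) (h1 : α < 1) (hk : #S ≤ k) :
    ∃ x : V → ℝ, (∀ v ∈ S, 0 < x v) ∧ (∀ v ∉ S, x v = 0) ∧ x o = 1 ∧
      (∀ v ∈ S, v ≠ o →
        r * x v ≤ ∑ u ∈ S, if H.Adj v u then α * x v + (1 - α) * x u else 0) ∧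
      branchWeight α p (#S - 1) ≤
        ∑ u ∈ S, if H.Adj o u then α * x o + (1 - α) * x u else 0 := by
  have hβ : 0 < 1 - α := sub_pos.mpr h1
  induction hS with
  | single o =>
    refine ⟨Pi.single o 1, by simp, fun v hv => ?_, by simp, by simp, ?_⟩
    · rw [mem_singleton] at hv
      simp [hv]
    · simp [hp.branchWeight_zero]
  | @join S S' o c hS hS' hd hrc ih ih' =>
    rw [card_union_of_disjoint hd] at hk
    obtain ⟨y, ypos, yzero, yone, ysub, yroot⟩ := ih (by omega)
    obtain ⟨z, zpos, zzero, zone, zsub, zroot⟩ := ih' (by omega)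
    have cS : 0 < #S := card_pos.mpr ⟨o, hS.root_mem⟩
    have cS' : 0 < #S' := card_pos.mpr ⟨c, hS'.root_mem⟩
    obtain ⟨N, hN⟩ := Nat.exists_eq_add_of_le' cS
    obtain ⟨N', hN'⟩ := Nat.exists_eq_add_of_le' cS'
    rw [hN, Nat.add_sub_cancel] at yroot
    rw [hN', Nat.add_sub_cancel] at zroot
    -- the entry at the new child is the one that a path hanging from `o` would have
    set t := p (N' + 1) / p (N' + 2) with ht
    have q1 := hp.pos (N' + 1) (by omega) (by omega)
    have q2 := hp.pos (N' + 2) (by omega) (by omega)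
    have tpos : 0 < t := div_pos q1 q2
    let x : V → ℝ := fun v => y v + t * z v
    have xS : ∀ v ∈ S, x v = y v := fun v hv => by
      simp [x, zzero v (Finset.disjoint_left.mp hd hv)]
    have xS' : ∀ v ∈ S', x v = t * z v := fun v hv => by
      simp [x, yzero v (Finset.disjoint_right.mp hd hv)]
    have xnn : ∀ v, 0 ≤ x v := by
      intro v
      by_cases h : v ∈ S
      · rw [xS v h]; exact (ypos v h).le
      · by_cases h' : v ∈ S'
        · rw [xS' v h']; exact (mul_pos tpos (zpos v h')).le
        · simp [x, yzero v h, zzero v h']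
    have tnn : ∀ v u, 0 ≤ if H.Adj v u then α * x v + (1 - α) * x u else 0 := by
      intro v u
      have := xnn v
      have := xnn u
      split_ifs <;> positivity
    have sumS : ∀ v ∈ S, (∑ u ∈ S, if H.Adj v u then α * x v + (1 - α) * x u else 0) =
        ∑ u ∈ S, if H.Adj v u then α * y v + (1 - α) * y u else 0 := fun v hv =>
      sum_congr rfl fun u hu => by rw [xS v hv, xS u hu]
    have sumS' : ∀ v ∈ S', (∑ u ∈ S', if H.Adj v u then α * x v + (1 - α) * x u else 0) =
        t * ∑ u ∈ S', if H.Adj v u then α * z v + (1 - α) * z u else 0 := fun v hv => by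
      rw [mul_sum]
      refine sum_congr rfl fun u hu => ?_
      rw [xS' v hv, xS' u hu]
      split_ifs <;> ring
    have xo : x o = 1 := by rw [xS o hS.root_mem, yone]
    have xc : x c = t := by rw [xS' c hS'.root_mem, zone, mul_one]
    refine ⟨x, fun v hv => ?_, fun v hv => ?_, xo, fun v hv hvo => ?_, ?_⟩
    · rcases mem_union.mp hv with h | h
      · rw [xS v h]; exact ypos v h
      · rw [xS' v h]; exact mul_pos tpos (zpos v h)
    · rw [mem_union, not_or] at hv
      simp [x, yzero v hv.1, zzero v hv.2]
    · rw [sum_union hd]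
      rcases mem_union.mp hv with h | h
      · have hrv : r * x v = r * y v := by rw [xS v h]
        rw [hrv, sumS v h]
        exact le_add_of_le_of_nonneg (ysub v h hvo) (sum_nonneg fun u _ => tnn v u)
      · rw [sumS' v h]
        by_cases hvc : v = c
        · subst hvc
          have hedge : α * t + (1 - α) ≤
              ∑ u ∈ S, if H.Adj v u then α * x v + (1 - α) * x u else 0 := by
            refine le_trans (le_of_eq ?_) (single_le_sum (fun u _ => tnn v u) hS.root_mem)
            rw [if_pos hrc.symm, xc, xo, mul_one]
          have hroot := mul_le_mul_of_nonneg_left zroot tpos.le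
          have hid : r * t = t * branchWeight α p N' + (α * t + (1 - α)) := by
            have hb := hp.branchWeight_mul (j := N') (by omega)
            have htq : t * p (N' + 2) = p (N' + 1) := div_mul_cancel₀ _ q2.ne'
            refine mul_right_cancel₀ q2.ne' ?_
            linear_combination (r - α - branchWeight α p N') * htq - hb - hp.recur N'
          have hrt : r * x v = t * branchWeight α p N' + (α * t + (1 - α)) := by rw [xc, hid]
          linarith
        · have hrv : r * x v = t * (r * z v) := by rw [xS' v h]; ring
          have := mul_le_mul_of_nonneg_left (zsub v h hvc) tpos.le
          have := sum_nonneg fun u (_ : u ∈ S) => tnn v u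
          linarith
    · rw [sum_union hd, sumS o hS.root_mem, card_union_of_disjoint hd, hN, hN',
        show N + 1 + (N' + 1) - 1 = N + (N' + 1) by omega]
      have hedge : branchWeight α p (N' + 1) ≤
          ∑ u ∈ S', if H.Adj o u then α * x o + (1 - α) * x u else 0 := by
        refine le_trans (le_of_eq ?_) (single_le_sum (fun u _ => tnn o u) hS'.root_mem)
        rw [if_pos hrc, xc, xo, mul_one, branchWeight, ht]
      have := hp.branchWeight_add_le h0 h1 (a := N) (b := N' + 1) (by omega)
      linarith

/-! ### Comparison with the path -/

open Classical in
/-- For `α = 1` the matrix of the path is the diagonal matrix of its degrees, so `ρ_1(P_k)` is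
`0`, `1` or `2` according to `k = 1`, `k = 2` or `k ≥ 3`. -/
theorem exists_rho_one_path_le {k : ℕ} (hk : 1 ≤ k) [DecidableEq V] {H : SimpleGraph V}
    {S : Finset V} {o : V} (hS : H.RootedTree S o) (hcard : #S = k) :
    ∃ v, (path k).rho 1 ≤ #{u ∈ S | H.Adj v u} := by
  obtain ⟨x, -, hx0, hx⟩ := exists_nonneg_eigenvector (α := 1) (by simp) (isMixedTree_path hk)
  change _ = (path k).rho 1 • x at hx
  obtain ⟨i, hi⟩ := Function.ne_iff.mp hx0
  have h := congrFun hx i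
  simp only [aAlpha_ofSimpleGraph_mulVec, sub_self, zero_mul, add_zero, one_mul, Pi.smul_apply,
    smul_eq_mul] at h
  rw [sum_pathGraph_adj i fun _ => x i] at h
  have hrho : (path k).rho 1 =
      (if 1 ≤ (i : ℕ) then 1 else 0) + if (i : ℕ) + 1 < k then 1 else 0 := by
    refine mul_right_cancel₀ hi ?_
    rw [← h]
    split_ifs <;> ring
  have hi := i.2
  rw [hrho]
  rcases (by omega : k = 1 ∨ k = 2 ∨ 3 ≤ k) with h1 | h2 | h3
  · refine ⟨o, ?_⟩
    rw [if_neg (by omega), if_neg (by omega), add_zero]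
    exact Nat.cast_nonneg _
  · obtain ⟨u, hu, hru⟩ := hS.exists_adj_root (by omega)
    refine ⟨o, ?_⟩
    have : 1 ≤ #{u ∈ S | H.Adj o u} := card_pos.mpr ⟨u, by simp [hu, hru]⟩
    refine le_trans ?_ (Nat.cast_le.mpr this)
    split_ifs <;> first | omega | norm_num
  · obtain ⟨v, -, hv⟩ := hS.exists_two_le_degree (by omega)
    refine ⟨v, le_trans ?_ (Nat.cast_le.mpr hv)⟩
    split_ifs <;> norm_num

open Classical in
theorem rho_path_le [Fintype V] [DecidableEq V] {α : ℝ} (hα : α ∈ Set.Icc (0 : ℝ) 1)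
    {T : MixedGraph V} (hT : T.IsMixedTree) {k : ℕ} (hk : 1 ≤ k) {o : V}
    (ho : k ≤ #{v | T.edge.Reachable o v}) : (path k).rho α ≤ T.rho α := by
  obtain ⟨S, hS, hcard⟩ := SimpleGraph.RootedTree.exists_card_eq T.edge o hk ho
  rcases hα.2.lt_or_eq with h1 | rfl
  · obtain ⟨p, hp⟩ := exists_isPathSequence hα.1 h1 hk
    obtain ⟨x, xpos, xzero, xone, xsub, xroot⟩ := hS.exists_subsolution hp hα.1 h1 hcard.le
    have hβ : 0 < 1 - α := sub_pos.mpr h1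
    have xnn : 0 ≤ x := fun v => by
      by_cases h : v ∈ S
      · exact (xpos v h).le
      · exact (xzero v h).ge
    refine le_rho_of_subsolution hα.1 hT xnn (fun h => by simp [h] at xone) fun v hv => ?_
    have hvS : v ∈ S := by_contra fun h => hv (xzero v h)
    refine le_trans ?_ (sum_le_sum_of_subset_of_nonneg (subset_univ S) fun u _ _ => ?_)
    · by_cases hvo : v = o
      · subst hvo
        rw [hcard, hp.branchWeight_last hk] at xroot
        refine le_trans (le_of_eq ?_) xroot
        rw [xone, mul_one]
      · exact xsub v hvS hvo
    · have := hα.1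
      have := xnn v
      have := xnn u
      simp only [Pi.zero_apply] at *
      split_ifs <;> positivity
  · obtain ⟨v, hv⟩ := exists_rho_one_path_le hk hS hcard
    refine le_rho_of_subsolution zero_le_one hT (x := Pi.single v 1)
      (Pi.single_nonneg.mpr zero_le_one) (by simp) fun u hu => ?_
    have huv : u = v := by
      by_contra h
      exact hu (by simp [h])
    subst huv
    simp only [Pi.single_eq_same, mul_one, sub_self, zero_mul, add_zero]
    refine hv.trans ?_
    rw [Finset.sum_boole]
    exact_mod_cast card_le_card (filter_subset_filter _ (subset_univ S))

/-! ### Isomorphism invariance -/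

theorem rho_eq_of_isomorphic [Fintype V] [DecidableEq V] [Fintype W] [DecidableEq W] (α : ℝ)
    {G : MixedGraph V} {H : MixedGraph W} (h : G.Isomorphic H) : G.rho α = H.rho α := by
  obtain ⟨e, hedge, harc⟩ := h
  have hout : ∀ u v, G.OutAdj u v ↔ H.OutAdj (e u) (e v) := fun u v => by
    rw [OutAdj, OutAdj, hedge, harc]
  have hdeg : ∀ u, G.outDegree u = H.outDegree (e u) := fun u => by
    rw [outDegree, outDegree, ← Set.ncard_image_of_injective _ e.injective]
    congr 1
    ext w
    obtain ⟨v, rfl⟩ := e.surjective w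
    simp [hout]
  have hM : (G.aAlpha α).reindex e e = H.aAlpha α := by
    ext u v
    obtain ⟨u, rfl⟩ := e.surjective u
    obtain ⟨v, rfl⟩ := e.surjective v
    by_cases h : H.OutAdj (e u) (e v) <;>
      simp [aAlpha, adjacency, diagonal_apply, hout, hdeg, h]
  have hE : G.realEigenvalues α = H.realEigenvalues α := by
    ext r
    rw [realEigenvalues, realEigenvalues, Set.mem_ofPred_eq, Set.mem_ofPred_eq,
      hasEigenvalue_mulVecLin_iff_isRoot_charpoly, hasEigenvalue_mulVecLin_iff_isRoot_charpoly,
      ← hM, charpoly_reindex]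
  rw [rho, rho, hE]

end MixedGraph

theorem theorem1p2 (α : ℝ) (hα : α ∈ Set.Icc (0 : ℝ) 1) :
    (∀ (V : Type*) [Fintype V] [DecidableEq V] (T : MixedGraph V) (n m k : ℕ),
      T.IsMixedTree → Fintype.card V = n → T.size = m →
      k = ⌈(n : ℚ) / (2 * (n : ℚ) - (m : ℚ) - 1)⌉₊ →
        IsGreatest (T.realEigenvalues α) (T.rho α) ∧
        IsGreatest ((MixedGraph.path k).realEigenvalues α) ((MixedGraph.path k).rho α) ∧
        (MixedGraph.path k).rho α ≤ T.rho α ∧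
        (T.Isomorphic (MixedGraph.path n) → T.rho α = (MixedGraph.path k).rho α)) ∧
    (∀ n : ℕ, 1 ≤ n →
      (MixedGraph.path n).IsMixedTree ∧ (MixedGraph.path n).size + 2 = 2 * n) := by
  refine ⟨fun V _ _ T n m k hT hn hm hk => ?_, fun n hn =>
    ⟨MixedGraph.isMixedTree_path hn, MixedGraph.size_path hn⟩⟩
  have hne : Nonempty V := hT.connected.nonempty
  have hn1 : 1 ≤ n := hn ▸ Fintype.card_pos
  have hcount := MixedGraph.ncard_arc_add_ncard_edgeSet hT
  rw [Nat.card_eq_fintype_card, hn] at hcount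
  rw [MixedGraph.size] at hm
  set a := {p : V × V | T.arc p.1 p.2}.ncard with ha
  -- the denominator is the number of components of the undirected part
  have hden : 2 * (n : ℚ) - m - 1 = a + 1 := by
    rw [← hcount, ← hm]
    push_cast
    ring
  rw [hden] at hk
  have ha1 : (0 : ℚ) < a + 1 := by positivity
  have hk1 : 1 ≤ k := by
    rw [hk, Nat.one_le_ceil_iff]
    positivity
  obtain ⟨r, hr⟩ := MixedGraph.exists_card_le_mul_card_reachable hT
  rw [hn, ← ha] at hr
  refine ⟨(MixedGraph.isGreatest_rho_and_rayleigh_le α hT).1,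
    (MixedGraph.isGreatest_rho_and_rayleigh_le α (MixedGraph.isMixedTree_path hk1)).1,
    MixedGraph.rho_path_le hα hT hk1 (o := r) ?_, fun hiso => ?_⟩
  · rw [hk, Nat.ceil_le, div_le_iff₀ ha1]
    rw [← Nat.cast_add_one, ← Nat.cast_mul, Nat.cast_le]
    convert hr
  have ha0 : a = 0 := by
    obtain ⟨e, -, harc⟩ := hiso
    rw [ha, Set.ncard_eq_zero, Set.eq_empty_iff_forall_notMem]
    exact fun p hp => (harc _ _).mp hp
  have hkn : k = n := by rw [hk, ha0]; simp
  rw [hkn]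
  exact MixedGraph.rho_eq_of_isomorphic α hiso
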